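/- \textbf{Setting.} Let $p\ge 1$, $n=\lfloor p\rfloor$, $T>0$, let $E,W,U$ be real Banach spaces and $(\Omega,\mathcal F,\mathbb P)$ a probability space. The $p$-variation of a path $y$ on $[0,T]$ is $\|y\|_{p\text{-var};[0,T]}=\big(\sup_\Pi\sum_{[s,t]\in\Pi}\|y_t-y_s\|^p\big)^{1/p}$, the supremum being over finite partitions of $[0,T]$. Sums $\sum_{[u,v]\in\Pi}\Xi_{u,v}$ converge to $K$ in the refinement Riemann--Stieltjes (RRS) sense if for every $\varepsilon>0$ there is a partition $\Pi_\varepsilon$ with $\|\sum_{[u,v]\in\Pi}\Xi_{u,v}-K\|<\varepsilon$ for all partitions $\Pi\supseteq\Pi_\varepsilon$. A control is a map $c(s,t)\ge0$ on $0\le s\le t\le T$ with $c(t,t)=0$ and $c(s,u)+c(u,t)\le c(s,t)$. $F\in\mathcal C_b^{m}(W,U)$ means that $F:W\to U$ is $m$ times continuously differentiable and $D^jF$ is bounded for $0\le j\le m$. For $F\in\mathcal C_b^{n+1}(W,U)$ and $y:[0,T]\to W$, the reduced rough integral is \[\int_0^T DF(y_t)\,d\mathbf y_t:=\text{RRS-}\lim_\Pi\sum_{[u,v]\in\Pi}\sum_{k=1}^{n}\frac1{k!}D^kF(y_u)(y_v-y_u)^{\otimes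 k}.\] \textbf{Equation.} Let $V:W\to\mathcal L(E,W)$ be a map and $y_0\in W$, and let $X:[0,T]\times\Omega\to E$ be a process that is almost surely càdlàg and of finite $p$-variation on $[0,T]$. Consider $dY_t=V(Y_t)\,dX_t$, $Y_0=y_0$. A solution concept (Young, controlled, Marcus, \dots) is specified, for each $\omega$, by the higher-order terms in the Riemann sums of the rough integrals: to every path $y$ it assigns $C^y_{u,v}\in W$ and, to every $F$ and $y$, $C^{F,y}_{u,v}\in U$ ($0\le u\le v\le T$); for càdlàg $y$ of finite $p$-variation (and $F\in\mathcal C_b^{n+1}(W,U)$) each of these is bounded in norm by $c(u,v)^{2/p}$ for some control $c$. In that concept, \[\int_0^tV(y_r)\,d\mathbf X_r=\text{RRS-}\lim_\Pi\sum_{[u,v]\in\Pi}\big(V(y_u)(X_v-X_u)+C^{y}_{u,v}\big),\] \[\int_0^TDF(y_r)V(y_r)\,d\mathbf X_r=\text{RRS-}\lim_\Pi\sum_{[u,v]\in\Pi}\big(DF(y_u)V(y_u)(X_v-X_u)+C^{F,y}_{u,v}\big),\] where $\Pi$ runs over partitions of $[0,t]$ and of $[0,T]$ respectively, and $y$ is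 a solution if $y(0)=y_0$ and, for all $t\in[0,T]$, $\int_0^tV(y_r)\,d\mathbf X_r$ exists and equals $y_t-y_0$. Nothing else is assumed about the solution concept. The substitution rule for $F$ is available along $\omega$ if, for every càdlàg solution $y$ of finite $p$-variation for which $\int_0^TDF(y_t)\,d\mathbf y_t$ exists, the integral $\int_0^TDF(y_t)V(y_t)\,d\mathbf X_t$ exists and has the same value. \textbf{Proposition.} Let $Y:[0,T]\times\Omega\to W$ be such that, for almost every $\omega$, $Y(\omega)$ is càdlàg, $\|Y(\omega)\|_{p\text{-var};[0,T]}<\infty$, and $Y(\omega)$ is a solution of the equation in the chosen concept. Then for every $F\in\mathcal C_b^{n+1}(W,U)$, almost surely the reduced rough integral exists, the jump series converges unconditionally, and \[F(Y_T)-F(Y_0)=\int_0^TDF(Y_t)\,d\mathbf Y_t+\sum_{0<t\le T}\Big(F(Y_t)-F(Y_{t-})-\sum_{k=1}^{n}\frac1{k!}D^kF(Y_{t-})(\Delta_t^-Y)^{\otimes k}\Big),\] where $\Delta^-_tY=Y_t-Y_{t-}$. Furthermore, if the substitution rule for $F$ is available almost surely, then almost surely $\int_0^TDF(Y_t)V(Y_t)\,d\mathbf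 X_t$ exists, \[\int_0^TDF(Y_t)\,d\mathbf Y_t=\int_0^TDF(Y_t)V(Y_t)\,d\mathbf X_t,\] and the formula holds with this integral in place of $\int_0^TDF(Y_t)\,d\mathbf Y_t$. -/

import Mathlib

open Set Filter Topology MeasureTheory
open scoped ENNReal

noncomputable section

namespace JumpIto

variable {E W U H : Type*}
  [NormedAddCommGroup E] [NormedSpace ℝ E]
  [NormedAddCommGroup W] [NormedSpace ℝ W]
  [NormedAddCommGroup U] [NormedSpace ℝ U]
  [NormedAddCommGroup H] [NormedSpace ℝ H]

/-! ### Partitions, Riemann sums and refinement limits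

Paths on `[0, T]` are represented by functions on `ℝ`; nothing below looks at their values
outside `[0, T]`. -/

/-- A finite partition of `[a, b]`, given by its set of points (which contains `a` and `b`). -/
def IsPartition (a b : ℝ) (P : Finset ℝ) : Prop :=
  a ∈ P ∧ b ∈ P ∧ ∀ x ∈ P, x ∈ Icc a b

/-- The Riemann sum of `Ξ u v` over the intervals `[u, v]` between consecutive points of `P`. -/
def partSum (P : Finset ℝ) (Ξ : ℝ → ℝ → H) : H :=
  (List.zipWith Ξ (P.sort (· ≤ ·)) (P.sort (· ≤ ·)).tail).sum

/-- The Riemann sums of `Ξ` over partitions of `[a, b]` converge to `K` in the refinement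
Riemann-Stieltjes (RRS) sense. -/
def HasRRSLimit (a b : ℝ) (Ξ : ℝ → ℝ → H) (K : H) : Prop :=
  ∀ ε : ℝ, 0 < ε → ∃ P₀ : Finset ℝ, IsPartition a b P₀ ∧
    ∀ P : Finset ℝ, IsPartition a b P → P₀ ⊆ P → ‖partSum P Ξ - K‖ < ε

/-! ### Path regularity -/

/-- The `p`-variation of `y` on `[0, T]`, as an extended nonnegative real. -/
def pVariation (p T : ℝ) (y : ℝ → H) : ℝ≥0∞ :=
  (⨆ (P : Finset ℝ) (_ : IsPartition 0 T P),
    ENNReal.ofReal (partSum P fun s t => ‖y t - y s‖ ^ p)) ^ (1 / p)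

/-- `y` is right-continuous with left limits on `[0, T]`. -/
def IsCadlag (T : ℝ) (y : ℝ → H) : Prop :=
  (∀ t ∈ Ico 0 T, Tendsto y (𝓝[>] t) (𝓝 (y t))) ∧
    ∀ t ∈ Ioc 0 T, ∃ l : H, Tendsto y (𝓝[<] t) (𝓝 l)

/-- A (jump) control function on `{(s, t) | 0 ≤ s ≤ t ≤ T}`. -/
def IsControl (T : ℝ) (c : ℝ → ℝ → ℝ) : Prop :=
  (∀ s t, 0 ≤ s → s ≤ t → t ≤ T → 0 ≤ c s t) ∧
  (∀ t ∈ Icc 0 T, c t t = 0) ∧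
  ∀ s u t, 0 ≤ s → s ≤ u → u ≤ t → t ≤ T → c s u + c u t ≤ c s t

/-- `F` is of class `C_b^m`: `m` times continuously differentiable, with `D^j F` bounded for
`j = 0, …, m`. -/
def IsCb (m : ℕ) (F : W → U) : Prop :=
  ContDiff ℝ m F ∧ ∀ j ≤ m, ∃ M : ℝ, ∀ w, ‖iteratedFDeriv ℝ j F w‖ ≤ M

/-! ### The two sides of the formula -/

/-- `∑_{k=1}^{⌊p⌋} (1/k!) D^k F(a) (b - a)^{⊗k}`. -/
def taylorTerms (p : ℝ) (F : W → U) (a b : W) : U :=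
  ∑ k ∈ Finset.Icc 1 ⌊p⌋₊,
    ((k.factorial : ℝ)⁻¹) • iteratedFDeriv ℝ k F a (fun _ => b - a)

/-- `I` is the reduced rough integral `∫₀ᵀ DF(y_t) d𝐲_t`: the RRS limit of the compensated sums
`∑_{[u,v]} ∑_{k=1}^{⌊p⌋} (1/k!) D^k F(y_u) (y_v - y_u)^{⊗k}`. -/
def HasReducedIntegral (p T : ℝ) (F : W → U) (y : ℝ → W) (I : U) : Prop :=
  HasRRSLimit 0 T (fun u v => taylorTerms p F (y u) (y v)) I

/-- The left-jump correction at time `t`: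
`F(y_t) - F(y_{t-}) - ∑_{k=1}^{⌊p⌋} (1/k!) D^k F(y_{t-}) (Δ_t^- y)^{⊗k}`. -/
def jumpTerm (p : ℝ) (F : W → U) (y : ℝ → W) (t : ℝ) : U :=
  F (y t) - F (Function.leftLim y t) - taylorTerms p F (Function.leftLim y t) (y t)

/-! ### Solutions of `dy = V(y) dx` -/

/-- `C` is a higher-order compensator for paths of finite `p`-variation: it is of second order,
`‖C_{s,t}‖ ≤ c(s,t)^{2/p}` for some control function `c`. -/
def IsCompensator (p T : ℝ) (C : ℝ → ℝ → H) : Prop :=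
  ∃ c : ℝ → ℝ → ℝ, IsControl T c ∧
    ∀ s t, 0 ≤ s → s ≤ t → t ≤ T → ‖C s t‖ ≤ c s t ^ (2 / p)

/-- `J` is the integral `∫₀ᵗ G_r d𝐱_r` with compensator `C`: the RRS limit of the compensated
left-point sums `∑_{[u,v]} (G_u (x_v - x_u) + C_{u,v})`. With `C = 0` this is the left-point
(Young) integral; with `C_{u,v} = ∑_{k ≥ 1} G^k_u 𝐱^{k+1}_{u,v}` it is the rough integral of a
controlled path `(G, G^1, G^2, …)`. -/
def HasRoughIntegral (G : ℝ → E →L[ℝ] H) (x : ℝ → E) (C : ℝ → ℝ → H) (t : ℝ) (J : H) : Prop :=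
  HasRRSLimit 0 t (fun u v => G u (x v - x u) + C u v) J

/-- A solution concept along one trajectory of the (lifted) driver. Solution concepts for
`dy = V(y) dx` (Young, controlled, Marcus, …) differ in the higher-order terms they add to the
first-order term `V(y_u) (x_v - x_u)` (resp. `DF(y_u) V(y_u) (x_v - x_u)`) in the Riemann sums
that define `∫ V(y) d𝐱` (resp. `∫ DF(y) V(y) d𝐱`); these terms are the data of the concept. -/
structure SolutionConcept (p T : ℝ) (W U : Type*)
    [NormedAddCommGroup W] [NormedSpace ℝ W] [NormedAddCommGroup U] [NormedSpace ℝ U] where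
  /-- the compensator of `∫ V(y) d𝐱` -/
  eqnComp : (ℝ → W) → ℝ → ℝ → W
  eqnComp_order : ∀ y, IsCadlag T y → pVariation p T y < ⊤ → IsCompensator p T (eqnComp y)
  /-- the compensator of `∫ DF(y) V(y) d𝐱` -/
  obsComp : (W → U) → (ℝ → W) → ℝ → ℝ → U
  obsComp_order : ∀ F y, IsCb (⌊p⌋₊ + 1) F → IsCadlag T y → pVariation p T y < ⊤ →
    IsCompensator p T (obsComp F y)

/-- `y` solves `dy = V(y) dx`, `y_0 = y₀` on `[0, T]` in the sense of the concept `S`: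
`y_t = y₀ + ∫₀ᵗ V(y_r) d𝐱_r` for all `t ∈ [0, T]`. -/
def IsSolution {p T : ℝ} (S : SolutionConcept p T W U) (V : W → E →L[ℝ] W) (y₀ : W)
    (x : ℝ → E) (y : ℝ → W) : Prop :=
  y 0 = y₀ ∧ ∀ t ∈ Icc 0 T,
    HasRoughIntegral (fun r => V (y r)) x (S.eqnComp y) t (y t - y₀)

/-- `J` is `∫₀ᵀ DF(y_t) V(y_t) d𝐱_t` in the sense of the concept `S`. -/
def HasObservableIntegral {p T : ℝ} (S : SolutionConcept p T W U) (V : W → E →L[ℝ] W)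
    (x : ℝ → E) (F : W → U) (y : ℝ → W) (J : U) : Prop :=
  HasRoughIntegral (fun r => (fderiv ℝ F (y r)).comp (V (y r))) x (S.obsComp F y) T J

/-- The substitution rule for `F` is available for the concept `S` (along the driver `x`): for
every càdlàg solution `y` of finite `p`-variation, if `∫₀ᵀ DF(y) d𝐲` exists, then
`∫₀ᵀ DF(y) V(y) d𝐱` exists and has the same value. -/
def SubstitutionRule {p T : ℝ} (S : SolutionConcept p T W U) (V : W → E →L[ℝ] W) (y₀ : W)
    (x : ℝ → E) (F : W → U) : Prop :=
  ∀ y : ℝ → W, IsCadlag T y → pVariation p T y < ⊤ → IsSolution S V y₀ x y →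
    ∀ I : U, HasReducedIntegral p T F y I → HasObservableIntegral S V x F y I

end JumpIto

end

/-!
The formula holds trajectory by trajectory, and the substitution rule, applied to the reduced
integral once that is known to exist, turns it into the formula with the integral against the driver.

Fix a càdlàg path `y` of finite `p`-variation and put `R a b = F b - F a - taylorTerms p F a b`.
Over a partition, the sums of `R (y u) (y v)` and of the Taylor terms add up to `F (y T) - F (y 0)`
(`partSum_sub_telescope`), so it suffices that the former converge, in the refinement sense, to the
unconditional sum of `R (y (t-)) (y t)` over the jump times.

By Taylor's formula `‖R a b‖ ≤ M ‖b - a‖ ^ (⌊p⌋ + 1)` (`IsCb.exists_norm_taylor_remainder_le`), an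
exponent larger than `p`. The `p`-th powers of the jumps are summable (`IsCadlag.sum_jump_le`), hence
so are the jump terms. Given `ε`, select finitely many jump times that carry the jump sum up to `ε`
and contain all jumps larger than `η / 2`, and refine the partition so that it contains these times,
a point just before each of them, and a mesh on whose half-open intervals `y` oscillates by at most
`η / 2` (`IsCadlag.exists_finset_osc`). At a selected time `v` continuity of `R` in its first variable
makes `R (y u) (y v)` close to `R (y (v-)) (y v)`; at all other partition points
`‖y v - y u‖ ≤ η`, so these contribute at most a small multiple of the `p`-variation sum. This is
`exists_hasSum_jump_and_hasRRSLimit`.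
-/

open Set Filter Topology MeasureTheory
open scoped ENNReal

namespace JumpIto

variable {W U H : Type*} [NormedAddCommGroup H]
  [NormedAddCommGroup W] [NormedSpace ℝ W]
  [NormedAddCommGroup U]

/-! ### Riemann sums as sums over the partition points -/

/-- The predecessor of `v` in `P`: the largest point of `P` below `v` (a junk value if there is
none). -/
noncomputable def predIn (P : Finset ℝ) (v : ℝ) : ℝ := sSup {x | x ∈ P ∧ x < v}

theorem isGreatest_predIn {P : Finset ℝ} {a v : ℝ} (ha : a ∈ P) (hav : a < v) :
    IsGreatest {x | x ∈ P ∧ x < v} (predIn P v) := by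
  have hfin : {x | x ∈ P ∧ x < v}.Finite := P.finite_toSet.subset fun x hx => hx.1
  have hne : {x | x ∈ P ∧ x < v}.Nonempty := ⟨a, ha, hav⟩
  exact ⟨hne.csSup_mem hfin, fun x hx => le_csSup hfin.bddAbove hx⟩

theorem predIn_eq {P : Finset ℝ} {u v : ℝ} (h : IsGreatest {x | x ∈ P ∧ x < v} u) :
    predIn P v = u := h.csSup_eq

theorem partSum_insert {s : Finset ℝ} {a m : ℝ} (ha : ∀ x ∈ s, a < x)
    (hm : IsLeast (s : Set ℝ) m) (Ξ : ℝ → ℝ → H) :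
    partSum (insert a s) Ξ = Ξ a m + partSum s Ξ := by
  have h1 : (insert a s).sort (· ≤ ·) = a :: s.sort (· ≤ ·) :=
    Finset.sort_insert _ (fun b hb => (ha b hb).le) fun h => lt_irrefl _ (ha a h)
  have h2 : s.sort (· ≤ ·) = m :: (s.erase m).sort (· ≤ ·) := by
    conv_lhs => rw [← Finset.insert_erase (Finset.mem_coe.1 hm.1)]
    exact Finset.sort_insert _ (fun b hb => hm.2 (Finset.mem_of_mem_erase hb))
      (Finset.notMem_erase m s)
  rw [partSum, partSum, h1, h2]
  simp

theorem partSum_singleton (a : ℝ) (Ξ : ℝ → ℝ → H) : partSum {a} Ξ = 0 := by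
  simp [partSum]

theorem isLeast_insert_of_lt {s : Finset ℝ} {a : ℝ} (ha : ∀ x ∈ s, a < x) :
    IsLeast (↑(insert a s) : Set ℝ) a :=
  ⟨by simp, fun x hx => by
    rcases Finset.mem_insert.1 (Finset.mem_coe.1 hx) with rfl | h
    exacts [le_rfl, (ha x h).le]⟩

theorem partSum_eq_sum (P : Finset ℝ) : ∀ {a : ℝ}, IsLeast (P : Set ℝ) a → ∀ Ξ : ℝ → ℝ → H,
    partSum P Ξ = ∑ v ∈ P.filter (a < ·), Ξ (predIn P v) v := by
  induction P using Finset.induction_on_min with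
  | empty => intro a h; simpa using h.1
  | insert b s hb ih =>
    intro a ha Ξ
    obtain rfl : a = b := ha.unique (isLeast_insert_of_lt hb)
    rcases s.eq_empty_or_nonempty with rfl | hs
    · simp [partSum_singleton, Finset.filter_singleton]
    have hm : IsLeast (s : Set ℝ) (s.min' hs) := s.isLeast_min' hs
    set m := s.min' hs
    have ham : a < m := hb m hm.1
    have hfilt : (insert a s).filter (a < ·) = insert m (s.filter (m < ·)) := by
      ext x
      simp only [Finset.mem_filter, Finset.mem_insert]
      constructor
      · rintro ⟨rfl | hx, h⟩
        · exact absurd h (lt_irrefl _)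
        · rcases (hm.2 hx).eq_or_lt with h | h
          exacts [Or.inl h.symm, Or.inr ⟨hx, h⟩]
      · rintro (rfl | ⟨hx, h⟩)
        · exact ⟨Or.inr hm.1, ham⟩
        · exact ⟨Or.inr hx, hb x hx⟩
    rw [partSum_insert hb hm, ih hm, hfilt, Finset.sum_insert (by simp)]
    congr 1
    · rw [predIn_eq (u := a)]
      refine ⟨⟨by simp, ham⟩, fun x hx => ?_⟩
      rcases Finset.mem_insert.1 hx.1 with rfl | h
      · exact le_rfl
      · exact absurd hx.2 (hm.2 h).not_gt
    · refine Finset.sum_congr rfl fun v hv => ?_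
      rw [predIn_eq (P := insert a s) (u := predIn s v)]
      have hg := isGreatest_predIn (Finset.mem_coe.1 hm.1) (Finset.mem_filter.1 hv).2
      refine ⟨⟨Finset.mem_insert_of_mem hg.1.1, hg.1.2⟩, fun x hx => ?_⟩
      rcases Finset.mem_insert.1 hx.1 with rfl | h
      · exact (hb _ hg.1.1).le
      · exact hg.2 ⟨h, hx.2⟩

theorem partSum_sub_telescope (g : ℝ → H) (P : Finset ℝ) : ∀ {a b : ℝ}, IsLeast (P : Set ℝ) a →
    IsGreatest (P : Set ℝ) b → partSum P (fun u v => g v - g u) = g b - g a := by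
  induction P using Finset.induction_on_min with
  | empty => intro a b h; simpa using h.1
  | insert c s hc ih =>
    intro a b ha hb
    obtain rfl : a = c := ha.unique (isLeast_insert_of_lt hc)
    rcases s.eq_empty_or_nonempty with rfl | hs
    · have : b = a := by simpa using hb.1
      simp [partSum_singleton, this]
    have hm : IsLeast (s : Set ℝ) (s.min' hs) := s.isLeast_min' hs
    have hbs : IsGreatest (s : Set ℝ) b := by
      refine ⟨?_, fun x hx => hb.2 (by simp [Finset.mem_coe.1 hx])⟩
      rcases Finset.mem_insert.1 (Finset.mem_coe.1 hb.1) with rfl | h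
      · exact absurd (hb.2 (by simp [hm.1] : _ ∈ _)) (hc _ hm.1).not_ge
      · exact h
    rw [partSum_insert hc hm, ih hm hbs]
    abel

theorem IsPartition.isLeast {a b : ℝ} {P : Finset ℝ} (h : IsPartition a b P) :
    IsLeast (P : Set ℝ) a := ⟨h.1, fun x hx => (h.2.2 x hx).1⟩

theorem IsPartition.isGreatest {a b : ℝ} {P : Finset ℝ} (h : IsPartition a b P) :
    IsGreatest (P : Set ℝ) b := ⟨h.2.1, fun x hx => (h.2.2 x hx).2⟩

theorem IsPartition.predIn_spec {a b v : ℝ} {P : Finset ℝ} (h : IsPartition a b P) (hv : a < v) :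
    predIn P v ∈ P ∧ predIn P v < v ∧ ∀ x ∈ P, x < v → x ≤ predIn P v :=
  have hg := isGreatest_predIn h.1 hv
  ⟨hg.1.1, hg.1.2, fun _ hx hxv => hg.2 ⟨hx, hxv⟩⟩

/-! ### Càdlàg paths -/

theorem IsCadlag.tendsto_leftLim {T t : ℝ} {y : ℝ → H} (hy : IsCadlag T y) (ht : t ∈ Ioc 0 T) :
    Tendsto y (𝓝[<] t) (𝓝 (Function.leftLim y t)) := by
  obtain ⟨l, hl⟩ := hy.2 t ht
  rwa [leftLim_eq_of_tendsto hl]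

/-- Around any time, a càdlàg path oscillates little on each side (the right side including the
time itself). -/
theorem IsCadlag.exists_small_osc {T t δ : ℝ} {y : ℝ → H} (hy : IsCadlag T y) (ht : t ∈ Icc 0 T)
    (hδ : 0 < δ) : ∃ η > 0,
    (∀ r ∈ Icc 0 T, ∀ s ∈ Icc 0 T, r ∈ Ioo (t - η) t → s ∈ Ioo (t - η) t → ‖y s - y r‖ ≤ δ) ∧
    (∀ r ∈ Icc 0 T, ∀ s ∈ Icc 0 T, r ∈ Ico t (t + η) → s ∈ Ico t (t + η) → ‖y s - y r‖ ≤ δ) := by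
  have key : ∀ l a b : H, dist a l < δ / 2 → dist b l < δ / 2 → ‖b - a‖ ≤ δ := by
    intro l a b ha hb
    rw [← dist_eq_norm]
    linarith [dist_triangle_right b a l]
  have hleft : ∃ η > 0, ∀ r ∈ Icc 0 T, ∀ s ∈ Icc 0 T, r ∈ Ioo (t - η) t → s ∈ Ioo (t - η) t →
      ‖y s - y r‖ ≤ δ := by
    rcases ht.1.eq_or_lt with h0 | h0
    · exact ⟨1, one_pos, fun r hr s _ hr' => absurd hr.1 (by linarith [hr'.2])⟩
    obtain ⟨l, hl⟩ := hy.2 t ⟨h0, ht.2⟩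
    obtain ⟨a, ha, h⟩ := mem_nhdsLT_iff_exists_Ioo_subset.1
      (hl (Metric.ball_mem_nhds l (half_pos hδ)))
    refine ⟨t - a, sub_pos.2 ha, fun r _ s _ hr hs => ?_⟩
    rw [sub_sub_cancel] at hr hs
    exact key l _ _ (h hr) (h hs)
  have hright : ∃ η > 0, ∀ r ∈ Icc 0 T, ∀ s ∈ Icc 0 T, r ∈ Ico t (t + η) → s ∈ Ico t (t + η) →
      ‖y s - y r‖ ≤ δ := by
    rcases ht.2.eq_or_lt with h0 | h0
    · refine ⟨1, one_pos, fun r hr s hs hr' hs' => ?_⟩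
      rw [show s = r by linarith [hr.2, hs.2, hr'.1, hs'.1], sub_self, norm_zero]
      exact hδ.le
    obtain ⟨b, hb, h⟩ := mem_nhdsGT_iff_exists_Ioo_subset.1
      (hy.1 t ⟨ht.1, h0⟩ (Metric.ball_mem_nhds (y t) (half_pos hδ)))
    have h' : ∀ r ∈ Ico t b, dist (y r) (y t) < δ / 2 := by
      intro r hr
      rcases hr.1.eq_or_lt with rfl | h1
      · simpa using hδ
      · exact h ⟨h1, hr.2⟩
    refine ⟨b - t, sub_pos.2 hb, fun r _ s _ hr hs => ?_⟩
    rw [add_sub_cancel] at hr hs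
    exact key _ _ _ (h' r hr) (h' s hs)
  obtain ⟨η₁, h₁, hl⟩ := hleft
  obtain ⟨η₂, h₂, hr⟩ := hright
  refine ⟨min η₁ η₂, lt_min h₁ h₂, fun r hr0 s hs0 hr' hs' => hl r hr0 s hs0 ?_ ?_,
    fun r hr0 s hs0 hr' hs' => hr r hr0 s hs0 ?_ ?_⟩
  · exact ⟨by linarith [hr'.1, min_le_left η₁ η₂], hr'.2⟩
  · exact ⟨by linarith [hs'.1, min_le_left η₁ η₂], hs'.2⟩
  · exact ⟨hr'.1, by linarith [hr'.2, min_le_right η₁ η₂]⟩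
  · exact ⟨hs'.1, by linarith [hs'.2, min_le_right η₁ η₂]⟩

/-- A càdlàg path oscillates by at most `δ` on each half-open interval `[x, x')` between
consecutive points of a suitable finite set. The half-open intervals are encoded by the condition
that no point of the set lies in `(r, s]`. -/
theorem IsCadlag.exists_finset_osc {T δ : ℝ} {y : ℝ → H} (hy : IsCadlag T y) (hδ : 0 < δ) :
    ∃ Q : Finset ℝ, ∀ r s, 0 ≤ r → r < s → s ≤ T → (∀ x ∈ Q, r < x → s < x) →
      ‖y s - y r‖ ≤ δ := by
  choose! η hη hl hr using fun t (ht : t ∈ Icc 0 T) => hy.exists_small_osc ht hδ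
  obtain ⟨A, hA, hcov⟩ := isCompact_Icc.elim_nhds_subcover (fun t => Ioo (t - η t) (t + η t))
    fun t ht => Ioo_mem_nhds (by linarith [hη t ht]) (by linarith [hη t ht])
  refine ⟨A ∪ A.image (fun t => t + η t), fun r s h0 hrs hsT hQ => ?_⟩
  have hr0 : r ∈ Icc 0 T := ⟨h0, by linarith⟩
  have hs0 : s ∈ Icc 0 T := ⟨by linarith, hsT⟩
  obtain ⟨t, htA, ht⟩ := mem_iUnion₂.1 (hcov hr0)
  have hs : s < t + η t := hQ _ (by
    rw [Finset.mem_union]; exact Or.inr (Finset.mem_image_of_mem _ htA)) ht.2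
  rcases lt_or_ge r t with h | h
  · have hst : s < t := hQ t (Finset.mem_union_left _ htA) h
    exact hl t (hA t htA) r hr0 s hs0 ⟨ht.1, h⟩ ⟨ht.1.trans hrs, hst⟩
  · exact hr t (hA t htA) r hr0 s hs0 ⟨h, ht.2⟩ ⟨h.trans hrs.le, hs⟩

/-! ### Finite `p`-variation -/

theorem exists_partSum_le_of_pVariation_lt_top {p T : ℝ} {y : ℝ → H} (hp : 0 < p)
    (h : pVariation p T y < ⊤) : ∃ B : ℝ, 0 ≤ B ∧ ∀ P : Finset ℝ, IsPartition 0 T P →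
      ∑ v ∈ P.filter (0 < ·), ‖y v - y (predIn P v)‖ ^ p ≤ B := by
  rw [pVariation, ENNReal.rpow_lt_top_iff_of_pos (by positivity)] at h
  refine ⟨(⨆ (P : Finset ℝ) (_ : IsPartition 0 T P),
    ENNReal.ofReal (partSum P fun s t => ‖y t - y s‖ ^ p)).toReal, ENNReal.toReal_nonneg,
    fun P hP => ?_⟩
  rw [← partSum_eq_sum P hP.isLeast fun u v => ‖y v - y u‖ ^ p,
    ← ENNReal.ofReal_le_iff_le_toReal h.ne]
  exact le_iSup₂ (f := fun (P : Finset ℝ) (_ : IsPartition 0 T P) =>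
    ENNReal.ofReal (partSum P fun s t => ‖y t - y s‖ ^ p)) P hP

/-- The `p`-th powers of the jumps of a càdlàg path of finite `p`-variation have bounded sums:
the partition containing `t` and `t - h` for all `t` in a finite set `S` sees, as `h → 0`, the
jumps at the points of `S`. -/
theorem IsCadlag.sum_jump_le {p T B : ℝ} {y : ℝ → H} (hp : 0 < p) (hy : IsCadlag T y)
    (hT : 0 < T)
    (hB : ∀ P : Finset ℝ, IsPartition 0 T P →
      ∑ v ∈ P.filter (0 < ·), ‖y v - y (predIn P v)‖ ^ p ≤ B)
    (S : Finset ℝ) (hS : ∀ t ∈ S, t ∈ Ioc 0 T) :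
    ∑ t ∈ S, ‖y t - Function.leftLim y t‖ ^ p ≤ B := by
  have hsub : ∀ t : ℝ, Tendsto (fun h : ℝ => t - h) (𝓝[>] 0) (𝓝[<] t) := by
    intro t
    refine tendsto_nhdsWithin_iff.2 ⟨?_, ?_⟩
    · have : Tendsto (fun h : ℝ => t - h) (𝓝 0) (𝓝 (t - 0)) := by
        exact (continuous_const.sub continuous_id).tendsto 0
      rw [sub_zero] at this
      exact this.mono_left nhdsWithin_le_nhds
    · filter_upwards [self_mem_nhdsWithin] with h hh
      simpa using hh
  have hev : ∀ x t : ℝ, x < t → ∀ᶠ h in 𝓝[>] (0 : ℝ), x < t - h := fun x t hxt =>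
    (hsub t).eventually (nhdsWithin_le_nhds (Ioi_mem_nhds hxt))
  have hlim : Tendsto (fun h : ℝ => ∑ t ∈ S, ‖y t - y (t - h)‖ ^ p) (𝓝[>] 0)
      (𝓝 (∑ t ∈ S, ‖y t - Function.leftLim y t‖ ^ p)) := by
    refine tendsto_finsetSum _ fun t ht => ?_
    have := ((hy.tendsto_leftLim (hS t ht)).comp (hsub t)).const_sub (y t)
    exact (this.norm).rpow_const (Or.inr hp.le)
  refine le_of_tendsto hlim ?_
  have e1 : ∀ᶠ h in 𝓝[>] (0 : ℝ), ∀ t ∈ S, 0 < t - h :=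
    (Finset.eventually_all S).2 fun t ht => hev 0 t (hS t ht).1
  have e2 : ∀ᶠ h in 𝓝[>] (0 : ℝ), ∀ t ∈ S, ∀ t' ∈ S, t < t' → t < t' - h :=
    (Finset.eventually_all S).2 fun t _ => (Finset.eventually_all S).2 fun t' _ => by
      by_cases h : t < t'
      · filter_upwards [hev t t' h] with _ h' _ using h'
      · exact Eventually.of_forall fun _ h' => absurd h' h
  filter_upwards [e1, e2, self_mem_nhdsWithin] with h h1 h2 h3
  have h3 : 0 < h := h3
  set P : Finset ℝ := insert 0 (insert T (S ∪ S.image fun t => t - h)) with hPdef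
  have hmem : ∀ x, x ∈ P ↔ x = 0 ∨ x = T ∨ x ∈ S ∨ ∃ t ∈ S, t - h = x := by
    intro x; simp [hPdef]
  have hP : IsPartition 0 T P := by
    refine ⟨by simp [hPdef], by simp [hPdef], fun x hx => ?_⟩
    rcases (hmem x).1 hx with rfl | rfl | hx | ⟨t, ht, rfl⟩
    · exact ⟨le_rfl, hT.le⟩
    · exact ⟨hT.le, le_rfl⟩
    · exact Ioc_subset_Icc_self (hS x hx)
    · exact ⟨(h1 t ht).le, by linarith [(hS t ht).2]⟩
  have hpred : ∀ t ∈ S, predIn P t = t - h := by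
    intro t ht
    refine predIn_eq ⟨⟨(hmem _).2 (Or.inr (Or.inr (Or.inr ⟨t, ht, rfl⟩))), by linarith⟩, ?_⟩
    rintro x ⟨hx, hxt⟩
    rcases (hmem x).1 hx with rfl | rfl | hx | ⟨s, hs, rfl⟩
    · exact (h1 t ht).le
    · exact absurd hxt (hS t ht).2.not_gt
    · exact (h2 x hx t ht hxt).le
    · rcases le_or_gt s t with hst | hst
      · linarith
      · linarith [h2 t ht s hs hst]
  calc ∑ t ∈ S, ‖y t - y (t - h)‖ ^ p = ∑ t ∈ S, ‖y t - y (predIn P t)‖ ^ p :=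
        Finset.sum_congr rfl fun t ht => by rw [hpred t ht]
    _ ≤ ∑ v ∈ P.filter (0 < ·), ‖y v - y (predIn P v)‖ ^ p :=
        Finset.sum_le_sum_of_subset_of_nonneg
          (fun t ht => Finset.mem_filter.2
            ⟨(hmem t).2 (Or.inr (Or.inr (Or.inl ht))), (hS t ht).1⟩)
          fun _ _ _ => by positivity
    _ ≤ B := hB P hP

/-! ### Riemann sums of superlinear two-point functions -/

theorem exists_pow_le_mul_rpow {p ε : ℝ} {N : ℕ} (hp : 0 < p) (hpN : p < N) (hε : 0 < ε) :
    ∃ η > 0, ∀ d : ℝ, 0 ≤ d → d ≤ η → d ^ N ≤ ε * d ^ p := by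
  refine ⟨ε ^ (1 / (N - p)), by positivity, fun d hd hdη => ?_⟩
  have hq : 0 < N - p := sub_pos.2 hpN
  calc d ^ N = d ^ (N - p) * d ^ p := by
        rw [← Real.rpow_add_of_nonneg hd hq.le hp.le, sub_add_cancel, Real.rpow_natCast]
    _ ≤ (ε ^ (1 / (N - p))) ^ (N - p) * d ^ p := by gcongr
    _ = ε * d ^ p := by
        rw [← Real.rpow_mul hε.le, one_div_mul_cancel hq.ne', Real.rpow_one]

/-- If `R` is of order `N > p` at the diagonal, then along a càdlàg path of finite `p`-variation
the Riemann sums of `R (y u) (y v)` retain only the jumps: intervals whose right endpoint is not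
one of finitely many large jump times contribute a multiple of `∑ ‖y v - y u‖ ^ N`, which is small
compared with the `p`-variation, and on the others `R (y u) (y v)` is close to
`R (y (v-)) (y v)`. -/
theorem exists_hasSum_jump_and_hasRRSLimit [CompleteSpace U] {p T M : ℝ} {N : ℕ} {y : ℝ → H}
    {R : H → H → U} (hp : 0 < p) (hT : 0 < T) (hpN : p < N) (hy : IsCadlag T y)
    (hvar : pVariation p T y < ⊤) (hM : 0 ≤ M) (hR : ∀ a b, ‖R a b‖ ≤ M * ‖b - a‖ ^ N)
    (hRc : ∀ b, Continuous fun a => R a b) :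
    ∃ J : U, HasSum (fun t : Ioc (0 : ℝ) T => R (Function.leftLim y t) (y t)) J ∧
      HasRRSLimit 0 T (fun u v => R (y u) (y v)) J := by
  obtain ⟨B, hB0, hB⟩ := exists_partSum_le_of_pVariation_lt_top hp hvar
  have hsummable_jump :
      Summable fun t : Ioc (0 : ℝ) T => ‖y t - Function.leftLim y t‖ ^ p := by
    refine summable_of_sum_le (c := B) (fun t => by positivity) fun u => ?_
    have := hy.sum_jump_le hp hT hB (u.map (Function.Embedding.subtype _)) (by
      intro t ht
      obtain ⟨s, _, rfl⟩ := Finset.mem_map.1 ht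
      exact s.2)
    rwa [Finset.sum_map] at this
  have hlarge : ∀ δ : ℝ, 0 < δ →
      ∀ᶠ t : Ioc (0 : ℝ) T in cofinite, ‖y t - Function.leftLim y t‖ ≤ δ := by
    intro δ hδ
    filter_upwards [hsummable_jump.tendsto_cofinite_zero.eventually
      (gt_mem_nhds (Real.rpow_pos_of_pos hδ p))] with t ht
    exact ((Real.rpow_lt_rpow_iff (norm_nonneg _) hδ.le hp).1 ht).le
  have hsummable : Summable fun t : Ioc (0 : ℝ) T => R (Function.leftLim y t) (y t) := by
    obtain ⟨η, hη, hpow⟩ := exists_pow_le_mul_rpow hp hpN one_pos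
    refine Summable.of_norm_bounded_eventually (hsummable_jump.mul_left M) ?_
    filter_upwards [hlarge η hη] with t ht
    refine (hR _ _).trans ?_
    gcongr
    simpa using hpow _ (norm_nonneg _) ht
  refine ⟨_, hsummable.hasSum, fun ε hε => ?_⟩
  set J := ∑' t : Ioc (0 : ℝ) T, R (Function.leftLim y t) (y t)
  -- With this factor the intervals off the selected jump times contribute at most
  -- `M * (ε / (3 * (M * B + 1))) * B < ε / 3`; the `+ 1` covers `M * B = 0`.
  have hε' : 0 < ε / (3 * (M * B + 1)) := by positivity
  obtain ⟨η, hη, hpow⟩ := exists_pow_le_mul_rpow hp hpN hε'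
  -- Two contributions of size `η / 2`: the oscillation before `v` and the jump at `v`.
  obtain ⟨Q, hQ⟩ := hy.exists_finset_osc (half_pos hη)
  obtain ⟨S', hS'fin, hS'sum⟩ : ∃ S' : Finset (Ioc (0 : ℝ) T),
      (∀ t ∉ S', ‖y t - Function.leftLim y t‖ ≤ η / 2) ∧
      ‖∑ t ∈ S', R (Function.leftLim y t) (y t) - J‖ < ε / 3 := by
    have h1 := hsummable.hasSum.eventually (Metric.ball_mem_nhds J (by positivity : 0 < ε / 3))
    have h2 := eventually_cofinite.1 (hlarge (η / 2) (half_pos hη))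
    obtain ⟨S', hS', hle⟩ := (h1.and (eventually_ge_atTop h2.toFinset)).exists
    refine ⟨S', fun t ht => ?_, by simpa [dist_eq_norm] using hS'⟩
    by_contra hcon
    exact ht (hle (by simpa using hcon))
  set S : Finset ℝ := S'.map (Function.Embedding.subtype _) with hSdef
  have hS : ∀ t ∈ S, t ∈ Ioc 0 T := by
    intro t ht
    obtain ⟨s, _, rfl⟩ := Finset.mem_map.1 ht
    exact s.2
  have hSjump : ∀ t ∈ Ioc 0 T, t ∉ S → ‖y t - Function.leftLim y t‖ ≤ η / 2 :=
    fun t ht htS => hS'fin ⟨t, ht⟩ fun h => htS (Finset.mem_map.2 ⟨_, h, rfl⟩)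
  have hSsum : ‖∑ t ∈ S, R (Function.leftLim y t) (y t) - J‖ < ε / 3 := by
    rw [hSdef, Finset.sum_map]; exact hS'sum
  -- Points so close to the left of the selected jump times that the `S.card` errors made there
  -- add up to at most `ε / 3`.
  have hκ : 0 < ε / (3 * (S.card + 1)) := by positivity
  have hleft : ∀ t ∈ S, ∃ l, l ∈ Ico 0 t ∧ ∀ s ∈ Ico l t,
      ‖R (y s) (y t) - R (Function.leftLim y t) (y t)‖ < ε / (3 * (S.card + 1)) := by
    intro t ht
    have h1 : Tendsto (fun s => R (y s) (y t)) (𝓝[<] t) (𝓝 (R (Function.leftLim y t) (y t))) :=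
      ((hRc (y t)).tendsto _).comp (hy.tendsto_leftLim (hS t ht))
    obtain ⟨a, ha, h⟩ := mem_nhdsLT_iff_exists_Ioo_subset.1 (h1 (Metric.ball_mem_nhds _ hκ))
    have hat : max a 0 < t := max_lt ha (hS t ht).1
    refine ⟨(max a 0 + t) / 2, ⟨by linarith [le_max_right a 0, (hS t ht).1], by linarith⟩,
      fun s hs => ?_⟩
    have : s ∈ Ioo a t := ⟨by linarith [le_max_left a 0, hs.1], hs.2⟩
    simpa [dist_eq_norm] using h this
  choose! l hl0 hl using hleft
  refine ⟨(insert 0 (insert T (S ∪ S.image l ∪ Q))).filter (· ∈ Icc 0 T), ?_, fun P hP hsub => ?_⟩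
  · refine ⟨?_, ?_, fun x hx => (Finset.mem_filter.1 hx).2⟩ <;> simp [hT.le]
  have hmem : ∀ x, x ∈ Icc 0 T → (x ∈ S ∨ (∃ t ∈ S, l t = x) ∨ x ∈ Q) → x ∈ P := by
    intro x hx h
    refine hsub (Finset.mem_filter.2 ⟨?_, hx⟩)
    simp only [Finset.mem_insert, Finset.mem_union, Finset.mem_image, or_assoc]
    exact Or.inr (Or.inr h)
  have hSP : S ⊆ P.filter (0 < ·) := fun t ht =>
    Finset.mem_filter.2 ⟨hmem t (Ioc_subset_Icc_self (hS t ht)) (Or.inl ht), (hS t ht).1⟩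
  rw [partSum_eq_sum P hP.isLeast, ← Finset.sum_sdiff hSP]
  have hbig : ‖∑ v ∈ S, R (y (predIn P v)) (y v) - ∑ v ∈ S, R (Function.leftLim y v) (y v)‖
      ≤ ε / 3 := by
    rw [← Finset.sum_sub_distrib]
    calc _ ≤ ∑ v ∈ S, ε / (3 * (S.card + 1)) := by
          refine norm_sum_le_of_le _ fun v hv => (hl v hv _ ?_).le
          obtain ⟨_, h2, h3⟩ := hP.predIn_spec (hS v hv).1
          refine ⟨h3 _ (hmem _ ⟨(hl0 v hv).1, ?_⟩ (Or.inr (Or.inl ⟨v, hv, rfl⟩))) (hl0 v hv).2, h2⟩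
          exact (hl0 v hv).2.le.trans (hS v hv).2
      _ ≤ ε / 3 := by
          rw [Finset.sum_const, nsmul_eq_mul, ← div_div, mul_div_assoc']
          rw [div_le_iff₀ (by positivity)]
          nlinarith
  have hosc : ∀ v ∈ P.filter (0 < ·) \ S, ‖y v - y (predIn P v)‖ ≤ η := by
    intro v hv
    obtain ⟨hv, hvS⟩ := Finset.mem_sdiff.1 hv
    obtain ⟨hvP, hv0⟩ := Finset.mem_filter.1 hv
    have hvT : v ∈ Ioc 0 T := ⟨hv0, (hP.2.2 v hvP).2⟩
    obtain ⟨h1, h2, h3⟩ := hP.predIn_spec hv0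
    have hu0 := (hP.2.2 _ h1).1
    have hlim : ‖Function.leftLim y v - y (predIn P v)‖ ≤ η / 2 := by
      refine le_of_tendsto ((hy.tendsto_leftLim hvT).sub_const _).norm ?_
      filter_upwards [Ioo_mem_nhdsLT h2] with s hs
      refine hQ _ s hu0 hs.1 (hs.2.le.trans hvT.2) fun x hx hux => ?_
      by_contra! hxs
      exact (h3 x (hmem x ⟨by linarith, by linarith [hs.2, hvT.2]⟩ (Or.inr (Or.inr hx)))
        (hxs.trans_lt hs.2)).not_gt hux
    calc ‖y v - y (predIn P v)‖
        ≤ ‖y v - Function.leftLim y v‖ + ‖Function.leftLim y v - y (predIn P v)‖ :=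
          norm_sub_le_norm_sub_add_norm_sub _ _ _
      _ ≤ η := by linarith [hSjump v hvT hvS]
  have hsmall : ‖∑ v ∈ P.filter (0 < ·) \ S, R (y (predIn P v)) (y v)‖ < ε / 3 := by
    calc _ ≤ ∑ v ∈ P.filter (0 < ·) \ S,
            M * (ε / (3 * (M * B + 1)) * ‖y v - y (predIn P v)‖ ^ p) := by
          refine norm_sum_le_of_le _ fun v hv => (hR _ _).trans ?_
          gcongr
          exact hpow _ (norm_nonneg _) (hosc v hv)
      _ = M * (ε / (3 * (M * B + 1))) *
            ∑ v ∈ P.filter (0 < ·) \ S, ‖y v - y (predIn P v)‖ ^ p := by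
          rw [Finset.mul_sum]
          exact Finset.sum_congr rfl fun _ _ => by ring
      _ ≤ M * (ε / (3 * (M * B + 1))) * B := by
          gcongr
          exact (Finset.sum_le_sum_of_subset_of_nonneg Finset.sdiff_subset
            fun _ _ _ => by positivity).trans (hB P hP)
      _ < ε / 3 := by
          have : M * (ε / (3 * (M * B + 1))) * B = ε / 3 * (M * B / (M * B + 1)) := by
            field_simp
          rw [this]
          have h1 : M * B / (M * B + 1) < 1 := (div_lt_one (by positivity)).2 (by linarith)
          nlinarith
  set a := ∑ v ∈ P.filter (0 < ·) \ S, R (y (predIn P v)) (y v)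
  set b := ∑ v ∈ S, R (y (predIn P v)) (y v)
  set c := ∑ t ∈ S, R (Function.leftLim y t) (y t)
  calc ‖a + b - J‖ = ‖a + (b - c) + (c - J)‖ := by congr 1; abel
    _ ≤ ‖a‖ + ‖b - c‖ + ‖c - J‖ := norm_add₃_le
    _ < ε := by linarith

/-! ### Taylor remainders -/

variable [NormedSpace ℝ U]

/-- The Taylor remainder of order `⌊p⌋` of a `C_b^{⌊p⌋ + 1}` function is of order `⌊p⌋ + 1`,
uniformly in the base point. -/
theorem IsCb.exists_norm_taylor_remainder_le [CompleteSpace U] {p : ℝ} {F : W → U}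
    (hF : IsCb (⌊p⌋₊ + 1) F) :
    ∃ M : ℝ, 0 ≤ M ∧ ∀ a b, ‖F b - F a - taylorTerms p F a b‖ ≤ M * ‖b - a‖ ^ (⌊p⌋₊ + 1) := by
  obtain ⟨M, hM⟩ := hF.2 (⌊p⌋₊ + 1) le_rfl
  have hM0 : 0 ≤ M := (norm_nonneg _).trans (hM 0)
  refine ⟨M, hM0, fun a b => ?_⟩
  have h := map_add_eq_sum_add_integral_iteratedFDeriv (f := F) (x := a) (y := b - a)
    (n := ⌊p⌋₊) fun t _ => by exact_mod_cast hF.1.contDiffAt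
  have hsum : ∑ k ∈ Finset.range (⌊p⌋₊ + 1),
      ((k.factorial : ℝ)⁻¹) • iteratedFDeriv ℝ k F a (fun _ => b - a) =
      F a + taylorTerms p F a b := by
    rw [Finset.range_eq_Ico, Finset.sum_eq_sum_Ico_succ_bot (Nat.succ_pos _)]
    simp [taylorTerms, Finset.Ico_add_one_right_eq_Icc]
  rw [add_sub_cancel, hsum] at h
  rw [sub_sub, sub_eq_of_eq_add' h, norm_smul]
  have hint : ‖∫ t in (0 : ℝ)..1, (1 - t) ^ ⌊p⌋₊ •
      iteratedFDeriv ℝ (⌊p⌋₊ + 1) F (a + t • (b - a)) (fun _ => b - a)‖ ≤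
      M * ‖b - a‖ ^ (⌊p⌋₊ + 1) * |(1 : ℝ) - 0| := by
    refine intervalIntegral.norm_integral_le_of_norm_le_const fun t ht => ?_
    rw [uIoc_of_le zero_le_one] at ht
    have h1 : ‖(1 - t) ^ ⌊p⌋₊‖ ≤ 1 := by
      rw [norm_pow, Real.norm_of_nonneg (by linarith [ht.2])]
      exact pow_le_one₀ (by linarith [ht.2]) (by linarith [ht.1])
    have h2 : ‖iteratedFDeriv ℝ (⌊p⌋₊ + 1) F (a + t • (b - a)) (fun _ => b - a)‖ ≤
        M * ‖b - a‖ ^ (⌊p⌋₊ + 1) := by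
      refine (ContinuousMultilinearMap.le_opNorm _ _).trans ?_
      simp only [Finset.prod_const, Finset.card_univ, Fintype.card_fin]
      gcongr
      exact hM _
    rw [norm_smul]
    calc _ ≤ 1 * (M * ‖b - a‖ ^ (⌊p⌋₊ + 1)) := by gcongr
      _ = _ := one_mul _
  have hfac : ‖((⌊p⌋₊.factorial : ℝ)⁻¹)‖ ≤ 1 := by
    rw [norm_inv, Real.norm_natCast]
    exact inv_le_one_of_one_le₀ (by exact_mod_cast ⌊p⌋₊.factorial_pos)
  calc _ ≤ 1 * (M * ‖b - a‖ ^ (⌊p⌋₊ + 1) * |(1 : ℝ) - 0|) := by gcongr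
    _ = _ := by simp

theorem IsCb.continuous_taylorTerms_left {p : ℝ} {F : W → U} (hF : IsCb (⌊p⌋₊ + 1) F) (b : W) :
    Continuous fun a => taylorTerms p F a b := by
  unfold taylorTerms
  refine continuous_finsetSum _ fun k hk => Continuous.const_smul ?_ _
  have hk' : k ≤ ⌊p⌋₊ + 1 := (Finset.mem_Icc.1 hk).2.trans (Nat.le_succ _)
  have h : Continuous (iteratedFDeriv ℝ k F) :=
    hF.1.continuous_iteratedFDeriv (by exact_mod_cast hk')
  exact h.eval (continuous_pi fun _ => continuous_const.sub continuous_id)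

/-! ### The change of variables formula -/

/-- The pathwise change of variables formula. The Taylor terms and the Taylor remainder over
`[u, v]` add up to the increment of `F ∘ y`, which telescopes, so that the reduced integral exists
once the Riemann sums of the remainders converge. -/
theorem exists_reducedIntegral_and_jumpSum [CompleteSpace U] {p T : ℝ} (hp : 1 ≤ p) (hT : 0 < T)
    {y : ℝ → W} (hy : IsCadlag T y) (hvar : pVariation p T y < ⊤) {F : W → U}
    (hF : IsCb (⌊p⌋₊ + 1) F) :
    ∃ I J : U, HasReducedIntegral p T F y I ∧
      HasSum (fun t : Ioc (0 : ℝ) T => jumpTerm p F y t) J ∧ F (y T) - F (y 0) = I + J := by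
  obtain ⟨M, hM, hR⟩ := hF.exists_norm_taylor_remainder_le
  obtain ⟨J, hJ, hlim⟩ := exists_hasSum_jump_and_hasRRSLimit (N := ⌊p⌋₊ + 1)
    (R := fun a b => F b - F a - taylorTerms p F a b) (by linarith) hT
    (by exact_mod_cast Nat.lt_floor_add_one p) hy hvar hM hR
    fun b => (continuous_const.sub hF.1.continuous).sub (hF.continuous_taylorTerms_left b)
  refine ⟨F (y T) - F (y 0) - J, J, fun ε hε => ?_, hJ, (sub_add_cancel _ _).symm⟩
  obtain ⟨P₀, hP₀, h⟩ := hlim ε hε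
  refine ⟨P₀, hP₀, fun P hP hsub => ?_⟩
  have hdecomp : partSum P (fun u v => F (y v) - F (y u) - taylorTerms p F (y u) (y v)) =
      F (y T) - F (y 0) - partSum P fun u v => taylorTerms p F (y u) (y v) := by
    rw [← partSum_sub_telescope (fun t => F (y t)) P hP.isLeast hP.isGreatest]
    simp only [partSum_eq_sum P hP.isLeast, Finset.sum_sub_distrib]
  have hclose := h P hP hsub
  rw [hdecomp, sub_right_comm, norm_sub_rev] at hclose
  exact hclose

end JumpIto

theorem mainTheorem7
    {Ω : Type*} [MeasurableSpace Ω] (ℙ : MeasureTheory.Measure Ω)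
    [MeasureTheory.IsProbabilityMeasure ℙ]
    {E W U : Type*}
    [NormedAddCommGroup E] [NormedSpace ℝ E] [CompleteSpace E]
    [NormedAddCommGroup W] [NormedSpace ℝ W] [CompleteSpace W]
    [NormedAddCommGroup U] [NormedSpace ℝ U] [CompleteSpace U]
    (p T : ℝ) (hp : 1 ≤ p) (hT : 0 < T)
    -- the driver
    (X : Ω → ℝ → E)
    (hX : ∀ᵐ ω ∂ℙ, JumpIto.IsCadlag T (X ω))
    (hXvar : ∀ᵐ ω ∂ℙ, JumpIto.pVariation p T (X ω) < ⊤)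
    -- the equation, the solution concept, and a solution
    (V : W → E →L[ℝ] W) (y₀ : W)
    (S : Ω → JumpIto.SolutionConcept p T W U)
    (Y : Ω → ℝ → W)
    (hY : ∀ᵐ ω ∂ℙ, JumpIto.IsCadlag T (Y ω))
    (hYvar : ∀ᵐ ω ∂ℙ, JumpIto.pVariation p T (Y ω) < ⊤)
    (hYsol : ∀ᵐ ω ∂ℙ, JumpIto.IsSolution (S ω) V y₀ (X ω) (Y ω))
    -- the observable
    (F : W → U) (hF : JumpIto.IsCb (⌊p⌋₊ + 1) F) :
    (∀ᵐ ω ∂ℙ, ∃ I J : U,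
      JumpIto.HasReducedIntegral p T F (Y ω) I ∧
      HasSum (fun t : Set.Ioc (0 : ℝ) T => JumpIto.jumpTerm p F (Y ω) t) J ∧
      F (Y ω T) - F (Y ω 0) = I + J) ∧
    ((∀ᵐ ω ∂ℙ, JumpIto.SubstitutionRule (S ω) V y₀ (X ω) F) →
      ∀ᵐ ω ∂ℙ, ∃ I J : U,
        JumpIto.HasReducedIntegral p T F (Y ω) I ∧
        JumpIto.HasObservableIntegral (S ω) V (X ω) F (Y ω) I ∧
        HasSum (fun t : Set.Ioc (0 : ℝ) T => JumpIto.jumpTerm p F (Y ω) t) J ∧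
        F (Y ω T) - F (Y ω 0) = I + J) := by
  have main : ∀ᵐ ω ∂ℙ, ∃ I J : U,
      JumpIto.HasReducedIntegral p T F (Y ω) I ∧
      HasSum (fun t : Set.Ioc (0 : ℝ) T => JumpIto.jumpTerm p F (Y ω) t) J ∧
      F (Y ω T) - F (Y ω 0) = I + J := by
    filter_upwards [hY, hYvar] with ω h1 h2
    exact JumpIto.exists_reducedIntegral_and_jumpSum hp hT h1 h2 hF
  refine ⟨main, fun hsub => ?_⟩
  filter_upwards [main, hsub, hY, hYvar, hYsol] with ω ⟨I, J, hI, hJ, h⟩ hsubst h1 h2 h3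
  exact ⟨I, J, hI, hsubst (Y ω) h1 h2 h3 I hI, hJ, h⟩
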